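/- **Theorem 1 (Statistical convergence).** Let $K\ge 1$ and $L\ge 2$ be integers, let $b_1<\dots<b_{L-1}$ be known real cut-offs, and let $f\colon\mathbb R\to[0,1]$ be a known link function: $f$ is strictly increasing and twice differentiable with $\lim_{x\to-\infty}f(x)=0$ and $\lim_{x\to\infty}f(x)=1$, and $f'$ is strictly log-concave and symmetric about $0$. Put $b_0=-\infty$, $b_L=\infty$, $f(-\infty)=0$, $f(\infty)=1$. Let $\alpha>0$ and $r=(r_1,\dots,r_K)\in\mathbb N^K$, $r_{\max}=\max_k r_k$, and let $$\mathcal P=\{\Theta\in\mathbb R^{d_1\times\dots\times d_K}:\ \operatorname{rank}(\Theta_{(k)})\le r_k \text{ for all } k,\ \max_\omega|\theta_\omega|\le\alpha\},$$ where $\Theta_{(k)}$ is the mode-$k$ unfolding of $\Theta$ (Tucker rank at most $r$). Let $\Theta^{\mathrm{true}}\in\mathcal P$, and let $\mathcal Y=(y_\omega)\in\{1,\dots,L\}^{d_1\times\dots\times d_K}$ be a random tensor with independent entries satisfying $$\mathbb P(y_\omega\le\ell)=f(b_\ell-\theta^{\mathrm{true}}_\omega),\qquad \ell=1,\dots,L-1.$$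 Consider the log-likelihood $$\mathcal L_{\mathcal Y}(\Theta)=\sum_\omega\sum_{\ell=1}^L \mathbf 1\{y_\omega=\ell\}\log\big[f(b_\ell-\theta_\omega)-f(b_{\ell-1}-\theta_\omega)\big],$$ let $g_\ell(\theta)=f(\theta+b_\ell)-f(\theta+b_{\ell-1})$, and let $$U_\alpha=\max_{\ell,\,|\theta|\le\alpha}\frac{|g_\ell'(\theta)|}{g_\ell(\theta)},\qquad L_\alpha=\min_{\ell,\,|\theta|\le\alpha}\Big[\frac{g_\ell'(\theta)^2}{g_\ell(\theta)^2}-\frac{g_\ell''(\theta)}{g_\ell(\theta)}\Big],\qquad \mathrm{MSE}(\Theta,\Theta^{\mathrm{true}})=\frac{1}{\prod_k d_k}\sum_\omega(\theta_\omega-\theta^{\mathrm{true}}_\omega)^2 .$$ Then there is a constant $c_1>0$ depending only on $K$ such that, with very high probability, every rank-constrained maximum likelihood estimator $\hat\Theta\in\arg\max_{\Theta\in\mathcal P}\mathcal L_{\mathcal Y}(\Theta)$ (a maximizer exists for all values of $\mathcal Y$, once $d_{\min}$ is large enough) satisfies $$\mathrm{MSE}(\hat\Theta,\Theta^{\mathrm{true}})\le\min\Big(4\alpha^2,\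 \frac{c_1U_\alpha^2\,r_{\max}^{K-1}}{L_\alpha^2}\,\frac{\sum_k d_k}{\prod_k d_k}\Big),$$ and the same bound holds, on the same event, simultaneously for all $\Theta\in\mathcal P$ with $\mathcal L_{\mathcal Y}(\Theta)\ge\mathcal L_{\mathcal Y}(\Theta^{\mathrm{true}})$. Here "with very high probability" means that the probability tends to $1$ faster than any polynomial in $d_{\min}=\min_k d_k$: for every $p\in\mathbb N$ there is $D$, depending only on $K$ and $p$, such that the probability is at least $1-d_{\min}^{-p}$ whenever $d_{\min}\ge D$. -/

import Mathlib

open Filter Topology MeasureTheory ProbabilityTheory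

noncomputable section

namespace OrdinalTensor

/-- A strictly log-concave function on the line: positive, with strictly concave logarithm. -/
def StrictLogConcave (φ : ℝ → ℝ) : Prop :=
  (∀ x, 0 < φ x) ∧ StrictConcaveOn ℝ Set.univ (fun x => Real.log (φ x))

/-- Link functions: strictly increasing and twice differentiable, with a strictly log-concave
symmetric derivative, and with `f (-∞) = 0` and `f ∞ = 1`
(so that `f` takes its values in `[0, 1]`). -/
structure IsLink (f : ℝ → ℝ) : Prop where
  strictMono : StrictMono f
  differentiable : Differentiable ℝ f
  differentiable_deriv : Differentiable ℝ (deriv f)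
  strictLogConcave_deriv : StrictLogConcave (deriv f)
  deriv_symm : ∀ x, deriv f (-x) = deriv f x
  tendsto_atBot : Tendsto f atBot (𝓝 0)
  tendsto_atTop : Tendsto f atTop (𝓝 1)

/-- Index set `[d₁] × ⋯ × [d_K]` of the entries of a tensor of dimension `d`. -/
abbrev Index {K : ℕ} (d : Fin K → ℕ) : Type := ∀ k, Fin (d k)

/-- Real tensors of order `K` and dimension `d`. -/
abbrev Tensor {K : ℕ} (d : Fin K → ℕ) : Type := Index d → ℝ

section Tensors

variable {K : ℕ} {d : Fin K → ℕ}

/-- Mode-`k` unfolding: the matrix with `d k` rows, whose columns are indexed by the multi-indices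
of the other modes. -/
def unfold (T : Tensor d) (k : Fin K) :
    Matrix (Fin (d k)) (∀ i : {i : Fin K // i ≠ k}, Fin (d i)) ℝ :=
  Matrix.of fun a c => T ((Equiv.piSplitAt k (fun i => Fin (d i))).symm (a, c))

/-- Tucker rank: the vector of ranks of the unfoldings. -/
def tuckerRank (T : Tensor d) (k : Fin K) : ℕ := (unfold T k).rank

/-- The parameter space: tensors of Tucker rank at most `r` with entries bounded by `α`. -/
def paramSpace (d r : Fin K → ℕ) (α : ℝ) : Set (Tensor d) :=
  {T | (∀ k, tuckerRank T k ≤ r k) ∧ ∀ ω, |T ω| ≤ α}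

/-- Mean squared error: the squared Frobenius distance divided by the number of entries. -/
def mse (S T : Tensor d) : ℝ := (∑ ω, (S ω - T ω) ^ 2) / ∏ k, (d k : ℝ)

end Tensors

section Likelihood

variable {M : ℕ}

/-- For cut-offs `b₁, …, b_M`, the values `f (b_j + t)`, `j = 0, …, M + 1`, with the conventions
`b₀ = -∞`, `b_{M+1} = ∞`, `f (-∞) = 0` and `f ∞ = 1`. -/
def cumLink (f : ℝ → ℝ) (b : Fin M → ℝ) (t : ℝ) : Fin (M + 2) → ℝ :=
  Fin.cons (α := fun _ => ℝ) 0 (Fin.snoc (α := fun _ => ℝ) (fun j => f (b j + t)) 1)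

/-- `g_ℓ(t) = f (b_ℓ + t) - f (b_{ℓ-1} + t)`; there are `L = M + 1` levels, and level `ℓ` of the
mathematical notation is the element `ℓ - 1` of `Fin (M + 1)`. -/
def g (f : ℝ → ℝ) (b : Fin M → ℝ) (l : Fin (M + 1)) (t : ℝ) : ℝ :=
  cumLink f b t l.succ - cumLink f b t l.castSucc

/-- `U_α`, the maximum of `|g_ℓ'| / g_ℓ` over all levels and `|θ| ≤ α`. -/
def U (f : ℝ → ℝ) (b : Fin M → ℝ) (α : ℝ) : ℝ :=
  sSup {u | ∃ (l : Fin (M + 1)) (θ : ℝ), |θ| ≤ α ∧ u = |deriv (g f b l) θ| / g f b l θ}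

/-- `L_α`, the minimum of `(g_ℓ' / g_ℓ)² - g_ℓ'' / g_ℓ` over all levels and `|θ| ≤ α`. -/
def curv (f : ℝ → ℝ) (b : Fin M → ℝ) (α : ℝ) : ℝ :=
  sInf {u | ∃ (l : Fin (M + 1)) (θ : ℝ), |θ| ≤ α ∧
    u = deriv (g f b l) θ ^ 2 / g f b l θ ^ 2 - deriv (deriv (g f b l)) θ / g f b l θ}

variable {K : ℕ} {d : Fin K → ℕ}

/-- Log-likelihood of the parameter `T` given the ordinal tensor `y`:
`∑_ω ∑_ℓ 1{y_ω = ℓ} log [f (b_ℓ - θ_ω) - f (b_{ℓ-1} - θ_ω)]`. -/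
def logLik (f : ℝ → ℝ) (b : Fin M → ℝ) (y : Index d → Fin (M + 1)) (T : Tensor d) : ℝ :=
  ∑ ω, ∑ l, if y ω = l then Real.log (g f b l (-T ω)) else 0

/-- `T` is a rank-constrained maximum likelihood estimate for the data `y`. -/
def IsMLE (f : ℝ → ℝ) (b : Fin M → ℝ) (r : Fin K → ℕ) (α : ℝ)
    (y : Index d → Fin (M + 1)) (T : Tensor d) : Prop :=
  T ∈ paramSpace d r α ∧ ∀ S ∈ paramSpace d r α, logLik f b y S ≤ logLik f b y T

/-- The cumulative link model: the entries of the random tensor `Y` are independent, with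
`P (Y_ω ≤ ℓ) = f (b_ℓ - θ_ω)` for every level `ℓ` but the last. -/
structure IsCumulativeLinkModel {Ω : Type*} [MeasurableSpace Ω] (μ : Measure Ω)
    (f : ℝ → ℝ) (b : Fin M → ℝ) (T : Tensor d) (Y : Index d → Ω → Fin (M + 1)) : Prop where
  measurable : ∀ ω, Measurable (Y ω)
  indep : iIndepFun Y μ
  cumulative : ∀ ω (l : Fin M), μ.real {x | Y ω x ≤ l.castSucc} = f (b l - T ω)

end Likelihood

/-- The error bound `min (4 α², c U_α² r_max^(K-1) / L_α² · ∑ d_k / ∏ d_k)`. -/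
def errorBound {K M : ℕ} (c : ℝ) (f : ℝ → ℝ) (b : Fin M → ℝ) (α : ℝ) (d r : Fin K → ℕ) : ℝ :=
  min (4 * α ^ 2)
    (c * U f b α ^ 2 * ((Finset.univ.sup r : ℕ) : ℝ) ^ (K - 1) / curv f b α ^ 2 *
      ((∑ k, (d k : ℝ)) / ∏ k, (d k : ℝ)))

end OrdinalTensor

end

/-! Write T for the true parameter and let S be any feasible tensor whose likelihood is at least
that of T. Strict log-concavity of `f'` passes to every `g_ℓ`, in the form `(log g_ℓ)'' < 0` with a
continuous second derivative (`curvedLogConcave_g`). By compactness the curvature on `[-α, α]` is at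
least `curv > 0`, and a second order expansion at T gives `curv / 2 * ‖S - T‖² ≤ ⟨score, T - S⟩`
(`logLik_le`).

The difference `T - S` has Tucker rank at most `2 r_max`. For such tensors the inner product is at
most the spectral norm of the score times `(2 r_max)^((K-1)/2) ‖S - T‖` (`sum_mul_le_of_form_le`);
the exponent involves `K - 1` rather than `K` because one mode is never expanded. Dividing by `‖S -
T‖` leaves a bound by the spectral norm.

The entries of the score are independent, bounded by `U`, and centred because `∑ g_ℓ' = 0`.
Hoeffding's inequality and a union bound over a product of `1/2`-nets bound its spectral norm by
`2^K √(8 U² ∑ d_k)` outside an event of probability at most `exp (-∑ d_k)`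
(`measure_spectral_compl_le`), which is smaller than any power of `1 / d_min`. This event depends on
the score at T only, so the bound is uniform in S. -/

namespace OrdinalTensor

/-- Twice continuously differentiable positive functions with `(log φ)'' < 0` everywhere. -/
structure CurvedLogConcave (φ : ℝ → ℝ) : Prop where
  pos : ∀ t, 0 < φ t
  differentiable : Differentiable ℝ φ
  differentiable_deriv : Differentiable ℝ (deriv φ)
  continuous_deriv_deriv : Continuous (deriv (deriv φ))
  curv_pos : ∀ t, deriv (deriv φ) t * φ t < deriv φ t ^ 2

/-! ### Link functions: regularity and log-concavity inequalities. -/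

namespace IsLink

variable {f : ℝ → ℝ} (hf : IsLink f)
include hf

lemma pos (t : ℝ) : 0 < f t := by
  have h1 : f (t - 1) < f t := hf.strictMono (by linarith)
  have h2 : 0 ≤ f (t - 1) := by
    refine le_of_tendsto hf.tendsto_atBot ?_
    filter_upwards [eventually_le_atBot (t - 1)] with s hs using hf.strictMono.monotone hs
  linarith

lemma lt_one (t : ℝ) : f t < 1 := by
  have h1 : f t < f (t + 1) := hf.strictMono (by linarith)
  have h2 : f (t + 1) ≤ 1 := by
    refine ge_of_tendsto hf.tendsto_atTop ?_
    filter_upwards [eventually_ge_atTop (t + 1)] with s hs using hf.strictMono.monotone hs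
  linarith

lemma deriv_pos (t : ℝ) : 0 < deriv f t := hf.strictLogConcave_deriv.1 t

lemma deriv_log_deriv (t : ℝ) :
    deriv (fun x => Real.log (deriv f x)) t = deriv (deriv f) t / deriv f t :=
  ((hf.differentiable_deriv t).hasDerivAt.log (hf.deriv_pos t).ne').deriv

lemma differentiable_log_deriv : Differentiable ℝ (fun x => Real.log (deriv f x)) :=
  fun t => ((hf.differentiable_deriv t).hasDerivAt.log (hf.deriv_pos t).ne').differentiableAt

lemma strictAnti_score : StrictAnti (fun t => deriv (deriv f) t / deriv f t) := by
  have h := hf.strictLogConcave_deriv.2.strictAntiOn_deriv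
    (fun x _ => hf.differentiable_log_deriv x)
  intro x y hxy
  have := h (Set.mem_univ x) (Set.mem_univ y) hxy
  simpa only [hf.deriv_log_deriv] using this

/-- Being the derivative of `log f'`, the score has the intermediate value property (Darboux), and a
strictly monotone function whose range is an interval is continuous. Thus mere twice
differentiability of `f` upgrades to `C²`. -/
lemma continuous_score : Continuous (fun t => deriv (deriv f) t / deriv f t) := by
  have hd : ∀ t, HasDerivAt (fun x => - Real.log (deriv f x))
      (-(deriv (deriv f) t / deriv f t)) t := fun t =>
    ((hf.differentiable_deriv t).hasDerivAt.log (hf.deriv_pos t).ne').neg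
  have hm : StrictMono (fun t => -(deriv (deriv f) t / deriv f t)) :=
    fun x y hxy => neg_lt_neg (hf.strictAnti_score hxy)
  have : Set.OrdConnected (Set.range (fun t => -(deriv (deriv f) t / deriv f t))) := by
    have := Set.ordConnected_univ.image_deriv (f := fun x => - Real.log (deriv f x))
      (fun x _ => (hd x).differentiableAt)
    rw [Set.image_univ] at this
    convert this using 3 with t
    exact (hd t).deriv.symm
  have h := (hm.isEmbedding_of_ordConnected this).continuous.neg
  exact h.congr fun t => neg_neg _

lemma continuous_deriv_deriv : Continuous (deriv (deriv f)) := by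
  have := hf.continuous_score.mul hf.differentiable_deriv.continuous
  refine this.congr fun t => ?_
  have := (hf.deriv_pos t).ne'
  simp [this]

/-- The auxiliary function `f' - h(a) f`, where `h = (log f')'`. -/
lemma hasDerivAt_aux (a t : ℝ) :
    HasDerivAt (fun x => deriv f x - deriv (deriv f) a / deriv f a * f x)
      (deriv f t * (deriv (deriv f) t / deriv f t - deriv (deriv f) a / deriv f a)) t := by
  have := (hf.differentiable_deriv t).hasDerivAt.sub
    ((hf.differentiable t).hasDerivAt.const_mul (deriv (deriv f) a / deriv f a))
  refine this.congr_deriv ?_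
  have := (hf.deriv_pos t).ne'
  rw [mul_sub, mul_div_cancel₀ _ this]
  ring

lemma continuous_aux (a : ℝ) :
    Continuous (fun x => deriv f x - deriv (deriv f) a / deriv f a * f x) :=
  hf.differentiable_deriv.continuous.sub (hf.differentiable.continuous.const_mul _)

/-- Strict log-concavity of `f`. With `h = (log f')'`, the function `f' - h(a) f` has derivative `f'
(h - h(a)) > 0` to the left of `a`, and it is nonnegative there because `f' > 0` and `f → 0` at
`-∞`. -/
lemma score_mul_lt_deriv (a : ℝ) : deriv (deriv f) a / deriv f a * f a < deriv f a := by
  set h := deriv (deriv f) a / deriv f a with hh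
  have hmono : StrictMonoOn (fun x => deriv f x - h * f x) (Set.Iic a) := by
    refine strictMonoOn_of_deriv_pos (convex_Iic a) (hf.continuous_aux a).continuousOn ?_
    intro x hx
    rw [interior_Iic] at hx
    rw [(hf.hasDerivAt_aux a x).deriv]
    exact mul_pos (hf.deriv_pos x) (sub_pos.2 (hf.strictAnti_score hx))
  have h1 : deriv f (a - 1) - h * f (a - 1) < deriv f a - h * f a :=
    hmono (by simp) (by simp) (by linarith)
  have h2 : 0 ≤ deriv f (a - 1) - h * f (a - 1) := by
    have ht : Tendsto (fun x => -(h * f x)) atBot (𝓝 (-(h * 0))) :=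
      (hf.tendsto_atBot.const_mul h).neg
    rw [mul_zero, neg_zero] at ht
    refine le_of_tendsto ht ?_
    filter_upwards [eventually_le_atBot (a - 1)] with s hs
    have h3 : deriv f s - h * f s ≤ deriv f (a - 1) - h * f (a - 1) :=
      hmono.monotoneOn (by simp only [Set.mem_Iic]; linarith) (by simp) hs
    linarith [hf.deriv_pos s]
  linarith

/-- The mirror image for `1 - f`: the same auxiliary function decreases to the right of `a`, and `f
→ 1` at `∞`. -/
lemma neg_score_mul_lt_deriv (a : ℝ) :
    -(deriv (deriv f) a / deriv f a) * (1 - f a) < deriv f a := by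
  set h := deriv (deriv f) a / deriv f a with hh
  have hanti : StrictAntiOn (fun x => deriv f x - h * f x) (Set.Ici a) := by
    refine strictAntiOn_of_deriv_neg (convex_Ici a) (hf.continuous_aux a).continuousOn ?_
    intro x hx
    rw [interior_Ici] at hx
    rw [(hf.hasDerivAt_aux a x).deriv]
    exact mul_neg_of_pos_of_neg (hf.deriv_pos x) (sub_neg.2 (hf.strictAnti_score hx))
  have h1 : deriv f (a + 1) - h * f (a + 1) < deriv f a - h * f a :=
    hanti (by simp) (by simp) (by linarith)
  have h2 : -h ≤ deriv f (a + 1) - h * f (a + 1) := by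
    have ht : Tendsto (fun x => -(h * f x)) atTop (𝓝 (-(h * 1))) :=
      (hf.tendsto_atTop.const_mul h).neg
    rw [mul_one] at ht
    refine le_of_tendsto ht ?_
    filter_upwards [eventually_ge_atTop (a + 1)] with s hs
    have h3 : deriv f s - h * f s ≤ deriv f (a + 1) - h * f (a + 1) :=
      hanti.antitoneOn (by simp) (by simp only [Set.mem_Ici]; linarith) hs
    linarith [hf.deriv_pos s]
  linarith

/-- Cauchy's mean value theorem writes the ratio of the increments of `f'` and `f` as `h(c)` with `a
< c < b`, and `h(b) < h(c) < h(a)` since `h` is strictly decreasing. -/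
lemma sub_mul_sub_lt {a b : ℝ} (hab : a < b) :
    (deriv (deriv f) b - deriv (deriv f) a) * (f b - f a) < (deriv f b - deriv f a) ^ 2 := by
  obtain ⟨c, hc, hce⟩ := exists_ratio_deriv_eq_ratio_slope (deriv f) hab
    hf.differentiable_deriv.continuous.continuousOn hf.differentiable_deriv.differentiableOn f
    hf.differentiable.continuous.continuousOn hf.differentiable.differentiableOn
  have hlt : 0 < f b - f a := sub_pos.2 (hf.strictMono hab)
  have hca := hf.strictAnti_score hc.1
  have hcb := hf.strictAnti_score hc.2
  have hpa := hf.deriv_pos a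
  have hpb := hf.deriv_pos b
  have hpc := hf.deriv_pos c
  simp only at hca hcb
  set m := deriv (deriv f) c / deriv f c with hm
  have e1 : deriv f b - deriv f a = m * (f b - f a) := by
    rw [hm]; field_simp; linarith
  have h1 : deriv (deriv f) b < m * deriv f b := by rwa [div_lt_iff₀ hpb] at hcb
  have h2 : m * deriv f a < deriv (deriv f) a := by rwa [lt_div_iff₀ hpa] at hca
  calc (deriv (deriv f) b - deriv (deriv f) a) * (f b - f a)
      < (m * deriv f b - m * deriv f a) * (f b - f a) :=
        mul_lt_mul_of_pos_right (by linarith) hlt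
    _ = (deriv f b - deriv f a) * (m * (f b - f a)) := by ring
    _ = _ := by rw [← e1]; ring

lemma hasDerivAt_shift (c t : ℝ) : HasDerivAt (fun t => f (c + t)) (deriv f (c + t)) t := by
  simpa using (hf.differentiable (c + t)).hasDerivAt.comp_const_add c t

lemma hasDerivAt_deriv_shift (c t : ℝ) :
    HasDerivAt (fun t => deriv f (c + t)) (deriv (deriv f) (c + t)) t := by
  simpa using (hf.differentiable_deriv (c + t)).hasDerivAt.comp_const_add c t

end IsLink

lemma CurvedLogConcave.of_hasDerivAt {φ φ' φ'' : ℝ → ℝ} (h0 : ∀ t, 0 < φ t)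
    (h1 : ∀ t, HasDerivAt φ (φ' t) t) (h2 : ∀ t, HasDerivAt φ' (φ'' t) t)
    (hc : Continuous φ'') (hlt : ∀ t, φ'' t * φ t < φ' t ^ 2) : CurvedLogConcave φ := by
  have e1 : deriv φ = φ' := funext fun t => (h1 t).deriv
  have e2 : deriv φ' = φ'' := funext fun t => (h2 t).deriv
  exact ⟨h0, fun t => (h1 t).differentiableAt, by rw [e1]; exact fun t => (h2 t).differentiableAt,
    by rwa [e1, e2], by rwa [e1, e2]⟩

/-! ### Level probabilities, the constants `U` and `curv`, and the quadratic bound. -/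

section Levels

variable {f : ℝ → ℝ} {M : ℕ} {b : Fin M → ℝ}

lemma cumLink_zero (t : ℝ) : cumLink f b t 0 = 0 := rfl

lemma cumLink_last (t : ℝ) : cumLink f b t (Fin.last (M + 1)) = 1 := by
  rw [← Fin.succ_last, cumLink, Fin.cons_succ, Fin.snoc_last]

lemma cumLink_mid (t : ℝ) (j : Fin M) : cumLink f b t j.castSucc.succ = f (b j + t) := by
  rw [cumLink, Fin.cons_succ, Fin.snoc_castSucc]

lemma sum_g (t : ℝ) : ∑ l, g f b l t = 1 := by
  simp only [g, Finset.sum_sub_distrib]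
  have h1 := Fin.sum_univ_succ (cumLink f b t)
  have h2 := Fin.sum_univ_castSucc (cumLink f b t)
  rw [cumLink_zero] at h1
  rw [cumLink_last] at h2
  linarith

/-- Lowest, highest and intermediate levels, one for each of the three inequalities on `f`. Without
cut-offs the only `g` would be the constant 1, which has no curvature. -/
lemma g_eq_cases (hM : 1 ≤ M) (hb : StrictMono b) (l : Fin (M + 1)) :
    (∃ B, g f b l = fun t => f (B + t)) ∨ (∃ A, g f b l = fun t => 1 - f (A + t)) ∨
      ∃ A B, A < B ∧ g f b l = fun t => f (B + t) - f (A + t) := by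
  obtain ⟨m, rfl⟩ : ∃ m, M = m + 1 := ⟨M - 1, by omega⟩
  induction l using Fin.cases with
  | zero =>
    left
    refine ⟨b 0, funext fun t => ?_⟩
    have := cumLink_mid (f := f) (b := b) t 0
    simp only [g, Fin.castSucc_zero, cumLink_zero, sub_zero]
    exact this
  | succ j =>
    right
    induction j using Fin.lastCases with
    | last =>
      left
      refine ⟨b (Fin.last m), funext fun t => ?_⟩
      rw [g, Fin.succ_last, Fin.succ_last, cumLink_last]
      congr 1
      exact cumLink_mid t (Fin.last m)
    | cast i =>
      right
      refine ⟨b i.castSucc, b i.succ, hb (Fin.castSucc_lt_succ), funext fun t => ?_⟩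
      have h1 := cumLink_mid (f := f) (b := b) t i.castSucc
      have h2 := cumLink_mid (f := f) (b := b) t i.succ
      rw [g, ← h1, ← h2]
      rfl

theorem curvedLogConcave_g (hf : IsLink f) (hM : 1 ≤ M) (hb : StrictMono b) (l : Fin (M + 1)) :
    CurvedLogConcave (g f b l) := by
  have hc : ∀ c : ℝ, Continuous fun t => deriv (deriv f) (c + t) := fun c =>
    hf.continuous_deriv_deriv.comp (continuous_const.add continuous_id)
  rcases g_eq_cases (f := f) hM hb l with ⟨B, hB⟩ | ⟨A, hA⟩ | ⟨A, B, hAB, hg⟩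
  · rw [hB]
    refine .of_hasDerivAt (fun t => hf.pos _) (hf.hasDerivAt_shift B)
      (hf.hasDerivAt_deriv_shift B) (hc B) fun t => ?_
    have h1 := hf.deriv_pos (B + t)
    have h2 := mul_lt_mul_of_pos_right (hf.score_mul_lt_deriv (B + t)) h1
    calc _ = deriv (deriv f) (B + t) / deriv f (B + t) * f (B + t) * deriv f (B + t) := by
            field_simp
      _ < _ := by rw [sq]; exact h2
  · rw [hA]
    refine .of_hasDerivAt (fun t => sub_pos.2 (hf.lt_one _))
      (fun t => (hf.hasDerivAt_shift A t).const_sub 1)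
      (fun t => (hf.hasDerivAt_deriv_shift A t).neg) (hc A).neg fun t => ?_
    have h1 := hf.deriv_pos (A + t)
    have h2 := mul_lt_mul_of_pos_right (hf.neg_score_mul_lt_deriv (A + t)) h1
    calc _ = -(deriv (deriv f) (A + t) / deriv f (A + t)) * (1 - f (A + t)) *
            deriv f (A + t) := by field_simp
      _ < _ := by rw [neg_sq, sq]; exact h2
  · rw [hg]
    exact .of_hasDerivAt (fun t => sub_pos.2 (hf.strictMono (by linarith)))
      (fun t => (hf.hasDerivAt_shift B t).sub (hf.hasDerivAt_shift A t))
      (fun t => (hf.hasDerivAt_deriv_shift B t).sub (hf.hasDerivAt_deriv_shift A t))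
      ((hc B).sub (hc A)) (fun t => hf.sub_mul_sub_lt (by linarith))

lemma sum_deriv_g (hf : IsLink f) (hM : 1 ≤ M) (hb : StrictMono b) (t : ℝ) :
    ∑ l, deriv (g f b l) t = 0 := by
  have h1 : HasDerivAt (fun t => ∑ l, g f b l t) (∑ l, deriv (g f b l) t) t :=
    HasDerivAt.fun_sum fun l _ => ((curvedLogConcave_g hf hM hb l).differentiable t).hasDerivAt
  simp only [sum_g] at h1
  exact h1.unique (hasDerivAt_const t 1)

variable {α : ℝ}

lemma isCompact_levels : IsCompact (Set.univ ×ˢ Set.Icc (-α) α : Set (Fin (M + 1) × ℝ)) :=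
  isCompact_univ.prod isCompact_Icc

lemma setOf_levels_eq (F : Fin (M + 1) → ℝ → ℝ) :
    {u | ∃ (l : Fin (M + 1)) (θ : ℝ), |θ| ≤ α ∧ u = F l θ} =
      (fun q : Fin (M + 1) × ℝ => F q.1 q.2) '' (Set.univ ×ˢ Set.Icc (-α) α) := by
  ext u
  simp only [Set.mem_ofPred_eq, Set.mem_image, Set.mem_prod, Set.mem_univ, true_and, Prod.exists]
  exact exists_congr fun l => exists_congr fun θ => and_congr abs_le eq_comm

/-- Makes `sSup` and `sInf` in `U` and `curv` genuine extrema instead of the default value 0 of an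
unbounded set; attainment is what makes `curv` positive. -/
lemma isCompact_setOf_levels {F : Fin (M + 1) → ℝ → ℝ} (hF : ∀ l, Continuous (F l)) :
    IsCompact {u | ∃ (l : Fin (M + 1)) (θ : ℝ), |θ| ≤ α ∧ u = F l θ} := by
  rw [setOf_levels_eq]
  exact isCompact_levels.image (continuous_prod_of_discrete_left.2 hF)

lemma CurvedLogConcave.continuous_abs_score {φ : ℝ → ℝ} (h : CurvedLogConcave φ) :
    Continuous fun t => |deriv φ t| / φ t :=
  h.differentiable_deriv.continuous.abs.div h.differentiable.continuous fun t => (h.pos t).ne'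

lemma CurvedLogConcave.continuous_curv {φ : ℝ → ℝ} (h : CurvedLogConcave φ) :
    Continuous fun t => deriv φ t ^ 2 / φ t ^ 2 - deriv (deriv φ) t / φ t :=
  ((h.differentiable_deriv.continuous.pow 2).div (h.differentiable.continuous.pow 2)
    fun t => (pow_pos (h.pos t) 2).ne').sub
    (h.continuous_deriv_deriv.div h.differentiable.continuous fun t => (h.pos t).ne')

lemma CurvedLogConcave.curv_quotient_pos {φ : ℝ → ℝ} (h : CurvedLogConcave φ) (t : ℝ) :
    0 < deriv φ t ^ 2 / φ t ^ 2 - deriv (deriv φ) t / φ t := by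
  have h0 := h.pos t
  have : deriv φ t ^ 2 / φ t ^ 2 - deriv (deriv φ) t / φ t =
      (deriv φ t ^ 2 - deriv (deriv φ) t * φ t) / φ t ^ 2 := by field_simp
  rw [this]
  exact div_pos (sub_pos.2 (h.curv_pos t)) (pow_pos h0 2)

lemma abs_score_le_U (hf : IsLink f) (hM : 1 ≤ M) (hb : StrictMono b) (l : Fin (M + 1)) {θ : ℝ}
    (hθ : |θ| ≤ α) : |deriv (g f b l) θ / g f b l θ| ≤ U f b α := by
  rw [abs_div, abs_of_pos ((curvedLogConcave_g hf hM hb l).pos θ)]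
  exact le_csSup (isCompact_setOf_levels
    fun l => (curvedLogConcave_g hf hM hb l).continuous_abs_score).bddAbove ⟨l, θ, hθ, rfl⟩

lemma curv_le (hf : IsLink f) (hM : 1 ≤ M) (hb : StrictMono b) (l : Fin (M + 1)) {θ : ℝ}
    (hθ : |θ| ≤ α) : curv f b α ≤
      deriv (g f b l) θ ^ 2 / g f b l θ ^ 2 - deriv (deriv (g f b l)) θ / g f b l θ :=
  csInf_le (isCompact_setOf_levels
    fun l => (curvedLogConcave_g hf hM hb l).continuous_curv).bddBelow ⟨l, θ, hθ, rfl⟩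

lemma curv_pos (hf : IsLink f) (hM : 1 ≤ M) (hb : StrictMono b) (hα : 0 ≤ α) :
    0 < curv f b α := by
  have hc := isCompact_setOf_levels (α := α)
    fun l => (curvedLogConcave_g hf hM hb l).continuous_curv
  obtain ⟨l, θ, -, h⟩ := hc.sInf_mem ⟨_, 0, 0, by simpa using hα, rfl⟩
  rw [curv, h]
  exact (curvedLogConcave_g hf hM hb l).curv_quotient_pos θ

lemma U_pos (hf : IsLink f) (hM : 1 ≤ M) (hb : StrictMono b) (hα : 0 ≤ α) : 0 < U f b α := by
  have hz : |(0 : ℝ)| ≤ α := by simpa using hα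
  have hc : ∀ l, |deriv (g f b l) 0 / g f b l 0| ≤ U f b α :=
    fun l => abs_score_le_U hf hM hb l hz
  refine lt_of_lt_of_le ?_ (hc 0)
  obtain ⟨m, rfl⟩ : ∃ m, M = m + 1 := ⟨M - 1, by omega⟩
  have h0 : g f b 0 = fun t => f (b 0 + t) := by
    funext t
    have := cumLink_mid (f := f) (b := b) t 0
    simp only [g, Fin.castSucc_zero, cumLink_zero, sub_zero]
    exact this
  rw [abs_pos, h0, (hf.hasDerivAt_shift _ _).deriv]
  exact div_ne_zero (hf.deriv_pos _).ne' (hf.pos _).ne'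

/-- Second order upper bound for `log g_ℓ` on `[-α, α]`. -/
lemma log_g_le (hf : IsLink f) (hM : 1 ≤ M) (hb : StrictMono b) (l : Fin (M + 1)) {s t : ℝ}
    (hs : |s| ≤ α) (ht : |t| ≤ α) :
    Real.log (g f b l t) ≤ Real.log (g f b l s) +
      deriv (g f b l) s / g f b l s * (t - s) - curv f b α / 2 * (t - s) ^ 2 := by
  have hG := curvedLogConcave_g hf hM hb l
  set G := g f b l
  set c := curv f b α
  -- The added square offsets exactly the guaranteed curvature, so `F` is still concave and lies
  -- below its tangent at `s`.
  set F : ℝ → ℝ := fun x => Real.log (G x) + c / 2 * (x - s) ^ 2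
  have h1 : ∀ x, HasDerivAt F (deriv G x / G x + c * (x - s)) x := fun x => by
    have e1 := (hG.differentiable x).hasDerivAt.log (hG.pos x).ne'
    have e2 := (((hasDerivAt_id x).sub_const s).pow 2).const_mul (c / 2)
    refine (e1.add e2).congr_deriv ?_
    simp only [id, Nat.cast_ofNat, Nat.add_one_sub_one, pow_one]
    ring
  have h2 : ∀ x, HasDerivAt (fun x => deriv G x / G x + c * (x - s))
      (-(deriv G x ^ 2 / G x ^ 2 - deriv (deriv G) x / G x) + c) x := fun x => by
    have e1 := (hG.differentiable_deriv x).hasDerivAt.div (hG.differentiable x).hasDerivAt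
      (hG.pos x).ne'
    have e2 := ((hasDerivAt_id x).sub_const s).const_mul c
    refine (e1.add e2).congr_deriv ?_
    have := (hG.pos x).ne'
    field_simp
    ring
  have hd : deriv F = fun x => deriv G x / G x + c * (x - s) := funext fun x => (h1 x).deriv
  have hconc : ConcaveOn ℝ (Set.Icc (-α) α) F := by
    refine concaveOn_of_deriv2_nonpos (convex_Icc _ _)
      (fun x _ => (h1 x).continuousAt.continuousWithinAt)
      (fun x _ => (h1 x).differentiableAt.differentiableWithinAt)
      (fun x _ => by rw [hd]; exact (h2 x).differentiableAt.differentiableWithinAt) fun x hx => ?_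
    have hx' : |x| ≤ α := abs_le.2 (Set.mem_Icc.1 (interior_subset hx))
    change deriv (deriv F) x ≤ 0
    rw [hd, (h2 x).deriv]
    have := curv_le hf hM hb l hx'
    linarith
  have hs' : s ∈ Set.Icc (-α) α := abs_le.1 hs
  have ht' : t ∈ Set.Icc (-α) α := abs_le.1 ht
  have hFs : F s = Real.log (G s) := by simp [F]
  have hds : deriv F s = deriv G s / G s := by simp [hd]
  have key : F t ≤ F s + deriv F s * (t - s) := by
    rcases lt_trichotomy s t with h | h | h
    · have := hconc.slope_le_deriv hs' ht' h (h1 s).differentiableAt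
      rw [slope_def_field, div_le_iff₀ (by linarith)] at this
      linarith
    · simp [h]
    · have := hconc.deriv_le_slope ht' hs' h (h1 s).differentiableAt
      rw [slope_def_field, le_div_iff₀ (by linarith)] at this
      linarith
  rw [hFs, hds] at key
  simp only [F] at key
  linarith

end Levels

/-! ### Matrix rank: subadditivity, closedness, adapted bases. -/

section Rank

lemma rank_sub_le_add {m n : Type*} [Finite m] [Fintype n] (A B : Matrix m n ℝ) :
    (A - B).rank ≤ A.rank + B.rank := by
  have : Fintype m := Fintype.ofFinite m
  have h : LinearMap.range (A - B).mulVecLin ≤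
      LinearMap.range A.mulVecLin ⊔ LinearMap.range B.mulVecLin := by
    rintro _ ⟨v, rfl⟩
    rw [Matrix.mulVecLin_apply, Matrix.sub_mulVec]
    exact Submodule.sub_mem_sup ⟨v, rfl⟩ ⟨v, rfl⟩
  exact (Submodule.finrank_mono h).trans (Submodule.finrank_add_le_finrank_add_finrank _ _)

lemma isClosed_rank_le {m n : Type*} [Fintype m] [Fintype n] (r : ℕ) :
    IsClosed {A : Matrix m n ℝ | A.rank ≤ r} := by
  classical
  have hcont : Continuous fun A : Matrix m n ℝ =>
      LinearMap.toContinuousLinearMap (A.mulVecLin) :=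
    (LinearMap.toContinuousLinearMap.toLinearMap ∘ₗ
      (Matrix.toLin' : Matrix m n ℝ ≃ₗ[ℝ] _).toLinearMap).continuous_of_finiteDimensional
  -- Rank is lower semicontinuous, so the complement, rank at least `r + 1`, is open.
  have ho := (isOpen_setOfPred_nat_le_rank (𝕜 := ℝ) (E := n → ℝ) (F := m → ℝ) (r + 1)).preimage
    hcont
  rw [← isOpen_compl_iff]
  convert ho using 1
  ext A
  simp only [Set.mem_compl_iff, Set.mem_ofPred_eq, not_le, Set.mem_preimage,
    LinearMap.coe_toContinuousLinearMap]
  rw [LinearMap.rank, ← Module.finrank_eq_rank, Nat.cast_le]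
  rfl

/-- An orthonormal basis of the space of columns in which the matrix has `rank A` nonzero rows. -/
lemma exists_orthonormalBasis_sum_eq_zero {m n : Type*} [Fintype m] [DecidableEq m] [Fintype n]
    (A : Matrix m n ℝ) :
    ∃ (u : OrthonormalBasis m ℝ (EuclideanSpace ℝ m)) (J : Finset m), J.card = A.rank ∧
      ∀ j ∉ J, ∀ c, ∑ a, u j a * A a c = 0 := by
  classical
  -- Eigenvectors of `A Aᵀ`: the kernel of `A Aᵀ` is that of `Aᵀ`, and the number of nonzero
  -- eigenvalues is the rank.
  have hA : (A * A.transpose).IsHermitian := by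
    simpa using Matrix.isHermitian_mul_conjTranspose_self A
  refine ⟨hA.eigenvectorBasis, Finset.univ.filter fun i => hA.eigenvalues i ≠ 0, ?_, ?_⟩
  · rw [← Matrix.rank_self_mul_transpose, hA.rank_eq_card_non_zero_eigs, Fintype.card_subtype]
  · intro j hj
    simp only [Finset.mem_filter, Finset.mem_univ, true_and, not_not] at hj
    have h1 := hA.mulVec_eigenvectorBasis j
    rw [hj, zero_smul] at h1
    have h2 := (Matrix.self_mul_conjTranspose_mulVec_eq_zero A
      (hA.eigenvectorBasis j).ofLp).1 (by simpa using h1)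
    intro c
    have h3 := congrFun h2 c
    simpa [Matrix.mulVec, dotProduct, mul_comm] using h3

end Rank

/-! ### Tensors as multilinear forms: spectral norm, duality, nets. -/

section Form

variable {K : ℕ} {d : Fin K → ℕ}

/-- The multilinear form of a tensor. -/
noncomputable def form (S : Tensor d) :
    MultilinearMap ℝ (fun k => EuclideanSpace ℝ (Fin (d k))) ℝ :=
  ∑ ω, S ω • (MultilinearMap.mkPiAlgebra ℝ (Fin K) ℝ).compLinearMap
    fun k => (EuclideanSpace.proj (𝕜 := ℝ) (ω k)).toLinearMap

lemma form_apply (S : Tensor d) (x : ∀ k, EuclideanSpace ℝ (Fin (d k))) :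
    form S x = ∑ ω, S ω * ∏ k, x k (ω k) := by
  simp [form, MultilinearMap.compLinearMap_apply]

lemma sum_orthonormalBasis_mul {m : Type*} [Fintype m] [DecidableEq m]
    (u : OrthonormalBasis m ℝ (EuclideanSpace ℝ m)) (a b : m) :
    ∑ j, u j a * u j b = if a = b then 1 else 0 := by
  have := u.sum_inner_mul_inner (EuclideanSpace.single a (1 : ℝ)) (EuclideanSpace.single b 1)
  simpa [EuclideanSpace.inner_single_left, EuclideanSpace.inner_single_right,
    Pi.single_apply, eq_comm] using this

/-- Parseval: the tensor products of the basis vectors form an orthonormal basis of the tensor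
space. -/
lemma sum_form_basis_mul (u : ∀ k, OrthonormalBasis (Fin (d k)) ℝ (EuclideanSpace ℝ (Fin (d k))))
    (S T : Tensor d) :
    ∑ i : Index d, form S (fun k => u k (i k)) * form T (fun k => u k (i k)) =
      ∑ ω, S ω * T ω := by
  classical
  have key : ∀ ω ω' : Index d,
      ∑ i : Index d, (∏ k, u k (i k) (ω k)) * ∏ k, u k (i k) (ω' k) =
        if ω = ω' then 1 else 0 := by
    intro ω ω'
    simp_rw [← Finset.prod_mul_distrib]
    have h := Finset.prod_univ_sum (fun k => (Finset.univ : Finset (Fin (d k))))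
      (fun k j => u k j (ω k) * u k j (ω' k))
    rw [Fintype.piFinset_univ] at h
    rw [← h]
    simp_rw [sum_orthonormalBasis_mul]
    rw [Finset.prod_ite_zero]
    simp [funext_iff]
  simp_rw [form_apply, Finset.sum_mul_sum]
  rw [Finset.sum_comm]
  refine Finset.sum_congr rfl fun ω _ => ?_
  rw [Finset.sum_comm]
  have : ∀ ω', ∑ i : Index d, S ω * (∏ k, u k (i k) (ω k)) * (T ω' * ∏ k, u k (i k) (ω' k)) =
      S ω * T ω' * if ω = ω' then 1 else 0 := fun ω' => by
    rw [← key, Finset.mul_sum]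
    exact Finset.sum_congr rfl fun i _ => by ring
  simp [this]

lemma sum_index_eq_sum_sum (k : Fin K) (F : Index d → ℝ) :
    ∑ ω, F ω = ∑ c : (∀ i : {i : Fin K // i ≠ k}, Fin (d i)), ∑ a,
      F ((Equiv.piSplitAt k (fun i => Fin (d i))).symm (a, c)) := by
  rw [← (Equiv.piSplitAt k (fun i => Fin (d i))).symm.sum_comp, Fintype.sum_prod_type_right]

lemma form_eq_zero_of_unfold (T : Tensor d) (x : ∀ k, EuclideanSpace ℝ (Fin (d k))) (k : Fin K)
    (h : ∀ c, ∑ a, x k a * unfold T k a c = 0) : form T x = 0 := by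
  rw [form_apply, sum_index_eq_sum_sum k]
  refine Finset.sum_eq_zero fun c _ => ?_
  have : ∀ a, T ((Equiv.piSplitAt k (fun i => Fin (d i))).symm (a, c)) *
      ∏ i, x i ((Equiv.piSplitAt k (fun i => Fin (d i))).symm (a, c) i) =
      (x k a * unfold T k a c) * ∏ i : {i // i ≠ k}, x i (c i) := by
    intro a
    rw [Fintype.prod_eq_mul_prod_subtype_ne _ k]
    have h1 : (Equiv.piSplitAt k (fun i => Fin (d i))).symm (a, c) k = a := by
      simp [Equiv.piSplitAt]
    have h2 : ∀ i : {i // i ≠ k},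
        (Equiv.piSplitAt k (fun i => Fin (d i))).symm (a, c) i = c i := fun i => by
      simp [Equiv.piSplitAt, i.2]
    simp_rw [h1, h2, unfold, Matrix.of_apply]
    ring
  simp_rw [this, ← Finset.sum_mul, h, zero_mul]

/-- Duality between the spectral norm and the Frobenius norm on tensors of low Tucker rank. -/
theorem sum_mul_le_of_form_le (S T : Tensor d) (k₀ : Fin K) {R : ℕ}
    (hR : ∀ k, tuckerRank T k ≤ R) {σ : ℝ} (hσ : 0 ≤ σ)
    (hS : ∀ x, |form S x| ≤ σ * ∏ k, ‖x k‖) :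
    (∑ ω, S ω * T ω) ^ 2 ≤ σ ^ 2 * (R : ℝ) ^ (K - 1) * ∑ ω, T ω ^ 2 := by
  classical
  choose u J hJ hu using fun k => exists_orthonormalBasis_sum_eq_zero (unfold T k)
  set e := (Equiv.piSplitAt k₀ (fun i => Fin (d i))).symm with he
  let x : (∀ i : {i : Fin K // i ≠ k₀}, Fin (d i)) → ∀ k, EuclideanSpace ℝ (Fin (d k)) :=
    fun c k => if h : k = k₀ then 0 else u k (c ⟨k, h⟩)
  have hx : ∀ a c, (fun k => u k (e (a, c) k)) = Function.update (x c) k₀ (u k₀ a) := by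
    intro a c
    funext k
    by_cases h : k = k₀
    · subst h
      simp [he, Equiv.piSplitAt]
    · simp [he, Equiv.piSplitAt, h, x]
  let t : Fin (d k₀) → (∀ i : {i : Fin K // i ≠ k₀}, Fin (d i)) → ℝ :=
    fun a c => form T (fun k => u k (e (a, c) k))
  -- All coefficients of `T` along mode `k₀` are gathered into one vector. Each `c` then costs one
  -- evaluation of `form S`, and only the at most `R ^ (K - 1)` indices in `C` contribute.
  let v : (∀ i : {i : Fin K // i ≠ k₀}, Fin (d i)) → EuclideanSpace ℝ (Fin (d k₀)) :=
    fun c => ∑ a, t a c • u k₀ a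
  have hv : ∀ c, ‖v c‖ ^ 2 = ∑ a, t a c ^ 2 := by
    intro c
    rw [← (u k₀).sum_sq_norm_inner_right (v c)]
    refine Finset.sum_congr rfl fun a _ => ?_
    have : inner ℝ (u k₀ a) (v c) = t a c := by
      simp only [v, inner_sum, inner_smul_right, (u k₀).inner_eq_ite]
      simp
    rw [this, Real.norm_eq_abs, sq_abs]
  let C := Fintype.piFinset fun i : {i : Fin K // i ≠ k₀} => J i
  have hC : (C.card : ℝ) ≤ (R : ℝ) ^ (K - 1) := by
    have h1 : C.card ≤ R ^ (K - 1) := by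
      rw [Fintype.card_piFinset]
      calc ∏ i : {i : Fin K // i ≠ k₀}, (J i).card
          ≤ ∏ _i : {i : Fin K // i ≠ k₀}, R :=
            Finset.prod_le_prod' fun i _ => (hJ i).trans_le (hR i)
        _ = R ^ (K - 1) := by simp [Fintype.card_subtype_compl]
    exact_mod_cast h1
  have ht : ∀ c ∉ C, ∀ a, t a c = 0 := by
    intro c hc a
    simp only [C, Fintype.mem_piFinset, not_forall] at hc
    obtain ⟨i, hi⟩ := hc
    refine form_eq_zero_of_unfold T _ i fun c' => ?_
    have h2 : e (a, c) i = c i := by simp [he, Equiv.piSplitAt, i.2]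
    rw [h2]
    exact hu i _ hi c'
  have hsum : ∑ ω, S ω * T ω = ∑ c ∈ C, form S (Function.update (x c) k₀ (v c)) := by
    rw [← sum_form_basis_mul u, sum_index_eq_sum_sum k₀]
    have h3 : ∀ c, ∑ a, form S (fun k => u k (e (a, c) k)) * form T (fun k => u k (e (a, c) k)) =
        form S (Function.update (x c) k₀ (v c)) := by
      intro c
      have : form S (Function.update (x c) k₀ (v c)) = (form S).toLinearMap (x c) k₀ (v c) := rfl
      rw [this]
      simp only [v, map_sum, map_smul, MultilinearMap.toLinearMap_apply, smul_eq_mul]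
      exact Finset.sum_congr rfl fun a _ => by rw [← hx, mul_comm]
    rw [Finset.sum_congr rfl fun c _ => h3 c]
    refine (Finset.sum_subset (Finset.subset_univ C) fun c _ hc => ?_).symm
    have : v c = 0 := by simp [v, ht c hc]
    rw [this]
    exact (form S).map_coord_zero k₀ (by simp)
  have hbd : ∀ c, form S (Function.update (x c) k₀ (v c)) ^ 2 ≤ σ ^ 2 * ∑ a, t a c ^ 2 := by
    intro c
    rw [← hv, ← mul_pow, sq_le_sq]
    refine (hS _).trans ?_
    rw [Fintype.prod_eq_mul_prod_subtype_ne _ k₀, abs_of_nonneg (by positivity)]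
    have : ∏ i : {i // i ≠ k₀}, ‖Function.update (x c) k₀ (v c) i‖ = 1 := by
      refine Finset.prod_eq_one fun i _ => ?_
      simp [i.2, x]
    simp [this]
  calc (∑ ω, S ω * T ω) ^ 2
      ≤ C.card * ∑ c ∈ C, form S (Function.update (x c) k₀ (v c)) ^ 2 := by
        rw [hsum]; exact sq_sum_le_card_mul_sum_sq
    _ ≤ C.card * ∑ c ∈ C, σ ^ 2 * ∑ a, t a c ^ 2 := by gcongr with c _; exact hbd c
    _ ≤ (R : ℝ) ^ (K - 1) * ∑ c, σ ^ 2 * ∑ a, t a c ^ 2 := by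
        gcongr
        exact Finset.subset_univ C
    _ = _ := by
        have h4 := sum_form_basis_mul u T T
        rw [sum_index_eq_sum_sum k₀] at h4
        simp_rw [sq (T _), ← h4, Finset.mul_sum]
        refine Finset.sum_congr rfl fun c _ => Finset.sum_congr rfl fun a _ => ?_
        simp only [t]
        ring

/-- A bound for a multilinear form on products of `1/2`-nets extends to all vectors. -/
lemma abs_multilinear_le_of_net {E : Fin K → Type*} [∀ k, NormedAddCommGroup (E k)]
    [∀ k, NormedSpace ℝ (E k)] [∀ k, FiniteDimensional ℝ (E k)]
    (F : MultilinearMap ℝ E ℝ) (N : ∀ k, Finset (E k))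
    (hN : ∀ k v, ‖v‖ ≤ 1 → ∃ n ∈ N k, ‖v - n‖ ≤ 1 / 2) {τ : ℝ}
    (hF : ∀ x ∈ Fintype.piFinset N, |F x| ≤ τ) (x : ∀ k, E k) (hx : ∀ k, ‖x k‖ ≤ 1) :
    |F x| ≤ 2 ^ K * τ := by
  classical
  -- Modes in `A` have been freed from the net; freeing one more doubles the bound, since `‖φ‖ ≤ B +
  -- ‖φ‖ / 2` gives `‖φ‖ ≤ 2 B`.
  have key : ∀ A : Finset (Fin K), ∀ x : ∀ k, E k, (∀ k ∈ A, ‖x k‖ ≤ 1) →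
      (∀ k ∉ A, x k ∈ N k) → |F x| ≤ 2 ^ A.card * τ := by
    intro A
    induction A using Finset.induction with
    | empty =>
      intro x _ hx
      simpa using hF x (by simpa using hx)
    | insert k A hk ih =>
      intro x h1 h2
      let φ : E k →L[ℝ] ℝ := LinearMap.toContinuousLinearMap (F.toLinearMap x k)
      have hφ : ∀ v, φ v = F (Function.update x k v) := fun v => rfl
      have hnet : ∀ n ∈ N k, |φ n| ≤ 2 ^ A.card * τ := by
        intro n hn
        rw [hφ]
        refine ih _ (fun i hi => ?_) (fun i hi => ?_)
        · have : i ≠ k := fun h => hk (h ▸ hi)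
          simpa [this] using h1 i (Finset.mem_insert_of_mem hi)
        · by_cases h : i = k
          · subst h; simpa using hn
          · simpa [h] using h2 i (by simp [h, hi])
      have hτ : 0 ≤ 2 ^ A.card * τ := by
        obtain ⟨n, hn, -⟩ := hN k 0 (by simp)
        exact (abs_nonneg _).trans (hnet n hn)
      have hball : ∀ v, ‖v‖ ≤ 1 → |φ v| ≤ 2 ^ A.card * τ + ‖φ‖ / 2 := by
        intro v hv
        obtain ⟨n, hn, hvn⟩ := hN k v hv
        have e : φ v = φ n + φ (v - n) := by rw [map_sub]; ring
        have h3 : |φ (v - n)| ≤ ‖φ‖ * ‖v - n‖ := φ.le_opNorm _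
        have h4 : ‖φ‖ * ‖v - n‖ ≤ ‖φ‖ * (1 / 2) := by gcongr
        rw [e]
        linarith [abs_add_le (φ n) (φ (v - n)), hnet n hn]
      have hop : ‖φ‖ ≤ 2 ^ A.card * τ + ‖φ‖ / 2 :=
        ContinuousLinearMap.opNorm_le_of_unit_norm (by positivity)
          fun v hv => hball v hv.le
      have hφx : φ (x k) = F x := by rw [hφ, Function.update_eq_self]
      have h5 : |φ (x k)| ≤ ‖φ‖ * ‖x k‖ := φ.le_opNorm _
      have h6 : ‖φ‖ * ‖x k‖ ≤ ‖φ‖ * 1 := by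
        gcongr; exact h1 k (Finset.mem_insert_self _ _)
      rw [Finset.card_insert_of_notMem hk, pow_succ, ← hφx]
      linarith
  simpa using key Finset.univ x (fun k _ => hx k) (by simp)

lemma abs_multilinear_le_mul_prod {E : Fin K → Type*} [∀ k, NormedAddCommGroup (E k)]
    [∀ k, NormedSpace ℝ (E k)] (F : MultilinearMap ℝ E ℝ) {σ : ℝ}
    (hF : ∀ x, (∀ k, ‖x k‖ ≤ 1) → |F x| ≤ σ) (x : ∀ k, E k) :
    |F x| ≤ σ * ∏ k, ‖x k‖ := by
  by_cases h : ∃ k, x k = 0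
  · obtain ⟨k, hk⟩ := h
    rw [F.map_coord_zero k hk, Finset.prod_eq_zero (Finset.mem_univ k) (by simp [hk])]
    simp
  · push Not at h
    have h1 := hF (fun k => ‖x k‖⁻¹ • x k) fun k => by
      rw [norm_smul, norm_inv, norm_norm, inv_mul_cancel₀ (norm_ne_zero_iff.2 (h k))]
    have hp : 0 < ∏ k, ‖x k‖ := Finset.prod_pos fun k _ => norm_pos_iff.2 (h k)
    rw [F.map_smul_univ, smul_eq_mul, abs_mul, Finset.prod_inv_distrib, abs_inv,
      abs_of_pos hp, inv_mul_le_iff₀ hp] at h1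
    linarith

/-- A 1-separated set in the ball of radius 2 has at most `5 ^ dim` points. One of maximal
cardinality is a 1-net of that ball, and halving it gives a `1/2`-net of the unit ball. -/
lemma exists_half_net (E : Type*) [NormedAddCommGroup E] [NormedSpace ℝ E]
    [FiniteDimensional ℝ E] :
    ∃ N : Finset E, N.card ≤ 5 ^ Module.finrank ℝ E ∧ (∀ n ∈ N, ‖n‖ ≤ 1) ∧
      ∀ v, ‖v‖ ≤ 1 → ∃ n ∈ N, ‖v - n‖ ≤ 1 / 2 := by
  classical
  let P : Finset E → Prop := fun s =>
    (∀ c ∈ s, ‖c‖ ≤ 2) ∧ ∀ c ∈ s, ∀ c' ∈ s, c ≠ c' → 1 ≤ ‖c - c'‖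
  have hbd : ∀ s, P s → s.card ≤ 5 ^ Module.finrank ℝ E := fun s hs =>
    Besicovitch.card_le_of_separated s hs.1 hs.2
  obtain ⟨s, hs, hmax⟩ : ∃ s, P s ∧ ∀ s', P s' → s'.card ≤ s.card := by
    have hne : ∃ n, ∃ s, P s ∧ s.card = n := ⟨0, ∅, by simp [P], rfl⟩
    have hb : ∀ n, (∃ s, P s ∧ s.card = n) → n ≤ 5 ^ Module.finrank ℝ E := by
      rintro n ⟨s, hs, rfl⟩; exact hbd s hs
    obtain ⟨n₀, h₀⟩ := hne
    obtain ⟨s, hs, hc⟩ := Nat.findGreatest_spec (P := fun n => ∃ s, P s ∧ s.card = n)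
      (hb n₀ h₀) h₀
    refine ⟨s, hs, fun s' hs' => ?_⟩
    rw [hc]
    exact Nat.le_findGreatest (hbd s' hs') ⟨s', hs', rfl⟩
  refine ⟨s.image fun c => (1 / 2 : ℝ) • c, Finset.card_image_le.trans (hbd s hs), ?_, ?_⟩
  · simp only [Finset.mem_image]
    rintro _ ⟨c, hc, rfl⟩
    rw [norm_smul]
    have := hs.1 c hc
    norm_num
    linarith
  · intro v hv
    by_contra! hcon
    have hfar : ∀ c ∈ s, 1 < ‖(2 : ℝ) • v - c‖ := by
      intro c hc
      have h1 := hcon _ (Finset.mem_image_of_mem _ hc)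
      have h2 : v - (1 / 2 : ℝ) • c = (1 / 2 : ℝ) • ((2 : ℝ) • v - c) := by
        rw [smul_sub, smul_smul]; norm_num
      rw [h2, norm_smul] at h1
      norm_num at h1
      linarith
    have hnot : (2 : ℝ) • v ∉ s := fun h => by
      have := hfar _ h
      simp at this
      linarith
    have hP : P (insert ((2 : ℝ) • v) s) := by
      refine ⟨fun c hc => ?_, fun c hc c' hc' hne => ?_⟩
      · rcases Finset.mem_insert.1 hc with rfl | hc
        · rw [norm_smul]; norm_num; linarith
        · exact hs.1 c hc
      · rcases Finset.mem_insert.1 hc with rfl | hc <;>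
          rcases Finset.mem_insert.1 hc' with rfl | hc'
        · exact absurd rfl hne
        · exact (hfar _ hc').le
        · rw [norm_sub_rev]; exact (hfar _ hc).le
        · exact hs.2 c hc c' hc' hne
    have := hmax _ hP
    rw [Finset.card_insert_of_notMem hnot] at this
    omega

end Form

/-! ### Compactness of the parameter space. -/

section ParamSpace

variable {K : ℕ} {d r : Fin K → ℕ} {α : ℝ}

lemma tuckerRank_sub_le (S T : Tensor d) (k : Fin K) :
    tuckerRank (S - T) k ≤ tuckerRank S k + tuckerRank T k :=
  rank_sub_le_add (unfold S k) (unfold T k)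

lemma isCompact_paramSpace : IsCompact (paramSpace d r α) := by
  have hcl : IsClosed (paramSpace d r α) := by
    have hset : paramSpace d r α =
        (⋂ k, {T : Tensor d | tuckerRank T k ≤ r k}) ∩ ⋂ ω, {T : Tensor d | |T ω| ≤ α} := by
      ext T; simp [paramSpace]
    rw [hset]
    refine (isClosed_iInter fun k => ?_).inter
      (isClosed_iInter fun ω => isClosed_le (continuous_apply ω).abs continuous_const)
    have hu : Continuous fun T : Tensor d => unfold T k :=
      continuous_matrix fun a c => continuous_apply _
    exact (isClosed_rank_le (r k)).preimage hu
  refine (isCompact_univ_pi fun _ : Index d => isCompact_Icc (a := -α) (b := α)).of_isClosed_subset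
    hcl fun T hT ω _ => abs_le.1 (hT.2 ω)

end ParamSpace

/-! ### Concentration of the spectral norm. -/

section Concentration

variable {Ω : Type*} [MeasurableSpace Ω] {μ : Measure Ω}

lemma _root_.ProbabilityTheory.HasSubgaussianMGF.mono_param {X : Ω → ℝ} {c c' : NNReal}
    (h : HasSubgaussianMGF X c μ) (hc : c ≤ c') : HasSubgaussianMGF X c' μ :=
  ⟨h.integrable_exp_mul, fun t => (h.mgf_le t).trans (by gcongr)⟩

variable [IsProbabilityMeasure μ]

/-- Hoeffding's inequality for a weighted sum of independent, centred variables in `[-u, u]`. -/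
lemma hoeffding_weighted {ι : Type*} [Fintype ι] {X : ι → Ω → ℝ} (hX : ∀ i, Measurable (X i))
    (hind : iIndepFun X μ) (hmean : ∀ i, ∫ x, X i x ∂μ = 0) {u : ℝ}
    (hbd : ∀ i x, |X i x| ≤ u) (w : ι → ℝ) (hw : ∑ i, w i ^ 2 ≤ 1) {τ : ℝ} (hτ : 0 ≤ τ) :
    μ.real {x | τ ≤ ∑ i, X i x * w i} ≤ Real.exp (-τ ^ 2 / (2 * u ^ 2)) := by
  -- Hoeffding's lemma: the parameter is the squared half-length of the interval, here `u² w_i²`.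
  let c : ι → NNReal := fun i => (‖u * |w i| - -(u * |w i|)‖₊ / 2) ^ 2
  have hc : ∀ i, (c i : ℝ) = u ^ 2 * w i ^ 2 := by
    intro i
    simp only [c, NNReal.coe_pow, NNReal.coe_div, coe_nnnorm, Real.norm_eq_abs, div_pow, sq_abs]
    have := sq_abs (w i)
    push_cast
    linear_combination u ^ 2 * this
  have hsub : ∀ i ∈ Finset.univ, HasSubgaussianMGF (fun x => X i x * w i) (c i) μ := by
    intro i _
    refine hasSubgaussianMGF_of_mem_Icc_of_integral_eq_zero ((hX i).mul_const _).aemeasurable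
      (Eventually.of_forall fun x => ?_) (by rw [integral_mul_const, hmean, zero_mul])
    have : |X i x * w i| ≤ u * |w i| := by
      rw [abs_mul]; exact mul_le_mul_of_nonneg_right (hbd i x) (abs_nonneg _)
    exact abs_le.1 this
  have hind' : iIndepFun (fun i x => X i x * w i) μ :=
    hind.comp (fun i y => y * w i) fun i => measurable_id.mul_const _
  have hsum := HasSubgaussianMGF.sum_of_iIndepFun hind' hsub
  have hle : ∑ i, c i ≤ Real.toNNReal (u ^ 2) := by
    rw [← NNReal.coe_le_coe, NNReal.coe_sum, Real.coe_toNNReal _ (sq_nonneg u)]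
    simp_rw [hc, ← Finset.mul_sum]
    exact mul_le_of_le_one_right (sq_nonneg u) hw
  have := (hsum.mono_param hle).measure_ge_le hτ
  rwa [Real.coe_toNNReal _ (sq_nonneg u)] at this

variable {K : ℕ} {d : Fin K → ℕ}

lemma sum_prod_coord_sq (x : ∀ k, EuclideanSpace ℝ (Fin (d k))) :
    ∑ ω : Index d, (∏ k, x k (ω k)) ^ 2 = ∏ k, ‖x k‖ ^ 2 := by
  have h := Finset.prod_univ_sum (fun k => (Finset.univ : Finset (Fin (d k))))
    (fun k a => x k a ^ 2)
  rw [Fintype.piFinset_univ] at h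
  simp_rw [EuclideanSpace.real_norm_sq_eq, h, Finset.prod_pow]

/-- The spectral norm of a random tensor with independent, centred and bounded entries. -/
theorem measure_spectral_compl_le (S : Index d → Ω → ℝ) (hS : ∀ ω, Measurable (S ω))
    (hind : iIndepFun S μ) (hmean : ∀ ω, ∫ x, S ω x ∂μ = 0) {u : ℝ} (hu : 0 < u)
    (hbd : ∀ ω x, |S ω x| ≤ u) {τ : ℝ} (hτ : 0 ≤ τ)
    (hτu : τ ^ 2 = 8 * u ^ 2 * ∑ k, (d k : ℝ)) (hd : 1 ≤ ∑ k, d k) :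
    μ.real {x | ¬ ∀ v, |form (fun ω => S ω x) v| ≤ 2 ^ K * τ * ∏ k, ‖v k‖} ≤
      Real.exp (-∑ k, (d k : ℝ)) := by
  classical
  choose N hNcard hNball hNnet using fun k => exists_half_net (EuclideanSpace ℝ (Fin (d k)))
  have htail : ∀ v ∈ Fintype.piFinset N,
      μ.real {x | τ ≤ |form (fun ω => S ω x) v|} ≤ 2 * Real.exp (-4 * ∑ k, (d k : ℝ)) := by
    intro v hv
    rw [Fintype.mem_piFinset] at hv
    have hw : ∑ ω : Index d, (∏ k, v k (ω k)) ^ 2 ≤ 1 := by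
      rw [sum_prod_coord_sq]
      exact Finset.prod_le_one (fun k _ => by positivity)
        fun k _ => pow_le_one₀ (norm_nonneg _) (hNball k _ (hv k))
    have h1 := hoeffding_weighted hS hind hmean hbd _ hw hτ
    have h2 := hoeffding_weighted hS hind hmean hbd (fun ω : Index d => -∏ k, v k (ω k))
      (by simpa only [neg_sq] using hw) hτ
    -- With `n = ∑ d_k`, the exponent `-4 n` pays for the net (`5 ^ n ≤ exp (2 n)`) and for the two
    -- signs (`2 ≤ exp n`, as `n ≥ 1`), leaving `exp (-n)`.
    have he : -τ ^ 2 / (2 * u ^ 2) = -4 * ∑ k, (d k : ℝ) := by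
      rw [hτu]; field_simp; ring
    rw [he] at h1 h2
    have hsub : {x | τ ≤ |form (fun ω => S ω x) v|} ⊆
        {x | τ ≤ ∑ ω, S ω x * ∏ k, v k (ω k)} ∪ {x | τ ≤ ∑ ω, S ω x * -∏ k, v k (ω k)} := by
      intro x hx
      simp only [Set.mem_ofPred_eq, form_apply, le_abs] at hx
      simpa only [Set.mem_union, Set.mem_ofPred_eq, mul_neg, Finset.sum_neg_distrib] using hx
    calc _ ≤ _ := measureReal_mono hsub
      _ ≤ _ := measureReal_union_le _ _
      _ ≤ _ := by linarith
  have hsub : {x | ¬ ∀ v, |form (fun ω => S ω x) v| ≤ 2 ^ K * τ * ∏ k, ‖v k‖} ⊆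
      ⋃ v ∈ Fintype.piFinset N, {x | τ ≤ |form (fun ω => S ω x) v|} := by
    intro x hx
    by_contra hcon
    refine hx (abs_multilinear_le_mul_prod _ (abs_multilinear_le_of_net _ N hNnet fun v hv => ?_))
    by_contra hlt
    exact hcon (Set.mem_biUnion hv (not_le.1 hlt).le)
  have hcard : ((Fintype.piFinset N).card : ℝ) ≤ 5 ^ ∑ k, d k := by
    have : (Fintype.piFinset N).card ≤ 5 ^ ∑ k, d k := by
      rw [Fintype.card_piFinset, ← Finset.prod_pow_eq_pow_sum]
      exact Finset.prod_le_prod' fun k _ => by simpa using hNcard k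
    exact_mod_cast this
  set n := ∑ k, d k with hn
  have hnc : ∑ k, (d k : ℝ) = n := by rw [hn]; push_cast; rfl
  have h5 : (5 : ℝ) ≤ Real.exp 2 := by
    have h1 := Real.exp_one_gt_d9
    have : Real.exp 2 = Real.exp 1 * Real.exp 1 := by rw [← Real.exp_add]; norm_num
    rw [this]; nlinarith
  have h2 : (2 : ℝ) ≤ Real.exp n := by
    have h3 : (1 : ℝ) ≤ n := by exact_mod_cast hd
    linarith [Real.add_one_le_exp (n : ℝ)]
  have h5n : (5 : ℝ) ^ n ≤ Real.exp (2 * n) := by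
    calc (5 : ℝ) ^ n ≤ Real.exp 2 ^ n := by gcongr
      _ = _ := by rw [← Real.exp_nat_mul]; ring_nf
  rw [hnc] at htail ⊢
  calc _ ≤ _ := measureReal_mono hsub (measure_ne_top _ _)
    _ ≤ ∑ v ∈ Fintype.piFinset N, μ.real {x | τ ≤ |form (fun ω => S ω x) v|} :=
        measureReal_biUnion_finset_le _ _
    _ ≤ (Fintype.piFinset N).card • (2 * Real.exp (-4 * n)) :=
        Finset.sum_le_card_nsmul _ _ _ htail
    _ ≤ Real.exp (2 * n) * (Real.exp n * Real.exp (-4 * n)) := by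
        rw [nsmul_eq_mul]; gcongr; exact hcard.trans h5n
    _ = Real.exp (-n) := by rw [← Real.exp_add, ← Real.exp_add]; ring_nf

end Concentration

/-! ### The likelihood, its score, and the deterministic error bound. -/

section Model

variable {K M : ℕ} {d : Fin K → ℕ} {f : ℝ → ℝ} {b : Fin M → ℝ} {α : ℝ}

/-- The derivative of the log-likelihood of level `l` at `-T ω`. -/
noncomputable def score (f : ℝ → ℝ) (b : Fin M → ℝ) (T : Tensor d) (ω : Index d)
    (l : Fin (M + 1)) : ℝ :=
  deriv (g f b l) (-T ω) / g f b l (-T ω)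

lemma logLik_eq (y : Index d → Fin (M + 1)) (T : Tensor d) :
    logLik f b y T = ∑ ω, Real.log (g f b (y ω) (-T ω)) := by
  simp [logLik]

lemma logLik_le (hf : IsLink f) (hM : 1 ≤ M) (hb : StrictMono b) (y : Index d → Fin (M + 1))
    {S T : Tensor d} (hS : ∀ ω, |S ω| ≤ α) (hT : ∀ ω, |T ω| ≤ α) :
    logLik f b y S ≤ logLik f b y T + ∑ ω, score f b T ω (y ω) * (T ω - S ω) -
      curv f b α / 2 * ∑ ω, (T ω - S ω) ^ 2 := by
  rw [logLik_eq, logLik_eq, Finset.mul_sum, ← Finset.sum_add_distrib, ← Finset.sum_sub_distrib]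
  refine Finset.sum_le_sum fun ω _ => ?_
  have := log_g_le hf hM hb (y ω) (s := -T ω) (t := -S ω) (by simpa using hT ω)
    (by simpa using hS ω)
  rwa [show -S ω - -T ω = T ω - S ω by ring] at this

lemma exists_isMLE (hf : IsLink f) (hM : 1 ≤ M) (hb : StrictMono b) {r : Fin K → ℕ}
    (hne : (paramSpace d r α).Nonempty) (y : Index d → Fin (M + 1)) :
    ∃ T, IsMLE f b r α y T := by
  have hc : Continuous fun T : Tensor d => logLik f b y T := by
    simp_rw [logLik_eq]
    refine continuous_finsetSum _ fun ω _ => Continuous.log ?_ fun T =>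
      ((curvedLogConcave_g hf hM hb (y ω)).pos _).ne'
    exact (curvedLogConcave_g hf hM hb (y ω)).differentiable.continuous.comp
      (continuous_apply ω).neg
  obtain ⟨T, hT, hmax⟩ := isCompact_paramSpace.exists_isMaxOn hne hc.continuousOn
  exact ⟨T, hT, fun S hS => hmax hS⟩

variable {Ω : Type*} [MeasurableSpace Ω] {μ : Measure Ω} [IsProbabilityMeasure μ]
  {T : Tensor d} {Y : Index d → Ω → Fin (M + 1)}

/-- The strict inequality in `Fin (M + 2)` covers both conventions at `±∞`, so that level
probabilities are differences at consecutive indices. -/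
lemma IsCumulativeLinkModel.measure_lt (h : IsCumulativeLinkModel μ f b T Y) (ω : Index d)
    (j : Fin (M + 2)) : μ.real {x | (Y ω x).castSucc < j} = cumLink f b (-T ω) j := by
  induction j using Fin.cases with
  | zero => simp [cumLink_zero]
  | succ j =>
    induction j using Fin.lastCases with
    | last =>
      rw [Fin.succ_last, cumLink_last]
      simp [Fin.castSucc_lt_last]
    | cast i =>
      rw [cumLink_mid, ← sub_eq_add_neg, ← h.cumulative ω i]
      simp [Fin.castSucc_lt_succ_iff]

lemma IsCumulativeLinkModel.measure_eq (h : IsCumulativeLinkModel μ f b T Y) (ω : Index d)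
    (l : Fin (M + 1)) : μ.real {x | Y ω x = l} = g f b l (-T ω) := by
  have hset : {x | Y ω x = l} =
      {x | (Y ω x).castSucc < l.succ} \ {x | (Y ω x).castSucc < l.castSucc} := by
    ext x
    simp [Fin.castSucc_lt_succ_iff, le_antisymm_iff]
  rw [hset, measureReal_sdiff, h.measure_lt, h.measure_lt, g]
  · intro x hx
    exact lt_trans hx Fin.castSucc_lt_succ
  · exact h.measurable ω (Set.toFinite {y | y.castSucc < l.castSucc}).measurableSet

/-- The expectation is `∑ g_ℓ * (g_ℓ' / g_ℓ) = ∑ g_ℓ'`, the derivative of the total probability 1.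
-/
lemma IsCumulativeLinkModel.integral_score (h : IsCumulativeLinkModel μ f b T Y) (hf : IsLink f)
    (hM : 1 ≤ M) (hb : StrictMono b) (ω : Index d) :
    ∫ x, score f b T ω (Y ω x) ∂μ = 0 := by
  have hY := h.measurable ω
  rw [← integral_map (f := score f b T ω) hY.aemeasurable
    (measurable_of_finite _).aestronglyMeasurable]
  have : IsProbabilityMeasure (μ.map (Y ω)) := Measure.isProbabilityMeasure_map hY.aemeasurable
  rw [integral_fintype .of_finite, ← sum_deriv_g hf hM hb (-T ω)]
  refine Finset.sum_congr rfl fun l _ => ?_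
  have hl : (μ.map (Y ω)).real {l} = g f b l (-T ω) := by
    rw [map_measureReal_apply hY (measurableSet_singleton l), ← h.measure_eq]
    rfl
  rw [hl, smul_eq_mul, score, mul_div_cancel₀ _ ((curvedLogConcave_g hf hM hb l).pos _).ne']

/-- With `F = ‖S - T‖²`, the expansion gives `curv / 2 * F ≤ P` and duality gives `P² ≤ σ² B F`;
squaring the first and cancelling one `F` gives the bound. -/
lemma sum_sq_le_of_form_score_le (hK : 1 ≤ K) (hf : IsLink f) (hM : 1 ≤ M) (hb : StrictMono b)
    (hα : 0 ≤ α) {r : Fin K → ℕ} {S : Tensor d} (hS : S ∈ paramSpace d r α)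
    (hT : T ∈ paramSpace d r α) {y : Index d → Fin (M + 1)} {σ : ℝ} (hσ : 0 ≤ σ)
    (hform : ∀ v, |form (fun ω => score f b T ω (y ω)) v| ≤ σ * ∏ k, ‖v k‖)
    (hlik : logLik f b y T ≤ logLik f b y S) :
    ∑ ω, (S ω - T ω) ^ 2 ≤
      4 * σ ^ 2 * (2 * (Finset.univ.sup r : ℕ) : ℝ) ^ (K - 1) / curv f b α ^ 2 := by
  have hc := curv_pos hf hM hb hα
  have h1 := logLik_le hf hM hb y hS.2 hT.2
  have hrank : ∀ k, tuckerRank (T - S) k ≤ 2 * Finset.univ.sup r := fun k => by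
    have h2 := tuckerRank_sub_le T S k
    have h3 := hT.1 k
    have h4 := hS.1 k
    have h5 : r k ≤ Finset.univ.sup r := Finset.le_sup (Finset.mem_univ k)
    omega
  have h2 := sum_mul_le_of_form_le (fun ω => score f b T ω (y ω)) (T - S) ⟨0, hK⟩ hrank hσ hform
  simp only [Pi.sub_apply] at h2
  push_cast at h2
  have hsymm : ∑ ω, (S ω - T ω) ^ 2 = ∑ ω, (T ω - S ω) ^ 2 :=
    Finset.sum_congr rfl fun ω _ => by ring
  rw [hsymm]
  set F := ∑ ω, (T ω - S ω) ^ 2 with hF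
  set P := ∑ ω, score f b T ω (y ω) * (T ω - S ω)
  set B := (2 * (Finset.univ.sup r : ℕ) : ℝ) ^ (K - 1)
  have hF0 : 0 ≤ F := Finset.sum_nonneg fun ω _ => sq_nonneg _
  have hB0 : 0 ≤ B := by positivity
  have h3 : curv f b α / 2 * F ≤ P := by linarith
  have h4 : (curv f b α / 2 * F) ^ 2 ≤ σ ^ 2 * B * F :=
    (pow_le_pow_left₀ (by positivity) h3 2).trans h2
  rw [le_div_iff₀ (by positivity)]
  rcases hF0.eq_or_lt with h0 | h0
  · rw [← h0, zero_mul]; positivity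
  · have h5 : (curv f b α ^ 2 * F) * F ≤ (4 * σ ^ 2 * B) * F := by nlinarith
    have := le_of_mul_le_mul_right h5 h0
    linarith

lemma mse_le_errorBound {r : Fin K → ℕ} {S : Tensor d} (hS : S ∈ paramSpace d r α)
    (hT : T ∈ paramSpace d r α) (hd : ∀ k, 1 ≤ d k) {u c : ℝ}
    (hu : u ^ 2 = 8 * U f b α ^ 2 * ∑ k, (d k : ℝ))
    (h : ∑ ω, (S ω - T ω) ^ 2 ≤
      4 * (2 ^ K * u) ^ 2 * (2 * (Finset.univ.sup r : ℕ) : ℝ) ^ (K - 1) / curv f b α ^ 2)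
    (hc : c = 32 * 4 ^ K * 2 ^ (K - 1)) :
    mse S T ≤ errorBound c f b α d r := by
  have hprod : 0 < ∏ k, (d k : ℝ) :=
    Finset.prod_pos fun k _ => by exact_mod_cast hd k
  refine le_min ?_ ?_
  · rw [mse, div_le_iff₀ hprod]
    have : ∀ ω, (S ω - T ω) ^ 2 ≤ 4 * α ^ 2 := fun ω => by
      have h1 := abs_le.1 (hS.2 ω)
      have h2 := abs_le.1 (hT.2 ω)
      nlinarith
    calc _ ≤ ∑ _ω : Index d, 4 * α ^ 2 := Finset.sum_le_sum fun ω _ => this ω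
      _ = 4 * α ^ 2 * ∏ k, (d k : ℝ) := by simp [Fintype.card_pi, mul_comm]
  · rw [mse, div_le_iff₀ hprod]
    refine h.trans (le_of_eq ?_)
    -- Sources of `c`: `32 = 4 * 8` from the quadratic inequality and from `u²`, `4 ^ K` from the
    -- nets, `2 ^ (K - 1)` from the doubled rank.
    rw [mul_pow _ u, hu, mul_pow (2 : ℝ) _ (K - 1), ← pow_mul, mul_comm K 2, pow_mul, hc]
    field_simp
    norm_num
    ring

end Model

lemma exists_forall_exp_neg_le (p : ℕ) :
    ∃ D : ℕ, 1 ≤ D ∧ ∀ n : ℕ, D ≤ n → Real.exp (-n) ≤ 1 / (n : ℝ) ^ p := by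
  have h := (Real.tendsto_pow_mul_exp_neg_atTop_nhds_zero p).comp tendsto_natCast_atTop_atTop
  obtain ⟨D, hD⟩ := eventually_atTop.1 (h.eventually (ge_mem_nhds (zero_lt_one' ℝ)))
  refine ⟨max D 1, le_max_right _ _, fun n hn => ?_⟩
  have hn1 : 0 < (n : ℝ) := by exact_mod_cast (le_max_right D 1).trans hn
  rw [le_div_iff₀ (by positivity), mul_comm]
  exact hD n ((le_max_left _ _).trans hn)

end OrdinalTensor

theorem theorem1 (K : ℕ) (hK : 1 ≤ K) :
    ∃ c₁ : ℝ, 0 < c₁ ∧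
      ∀ p : ℕ, ∃ D : ℕ,
        ∀ (M : ℕ) (_ : 1 ≤ M) (f : ℝ → ℝ) (_ : OrdinalTensor.IsLink f)
          (b : Fin M → ℝ) (_ : StrictMono b) (α : ℝ) (_ : 0 < α)
          (d r : Fin K → ℕ) (_ : D ≤ ⨅ k, d k)
          (Θtrue : OrdinalTensor.Tensor d) (_ : Θtrue ∈ OrdinalTensor.paramSpace d r α)
          (Ω : Type*) [MeasurableSpace Ω] (μ : MeasureTheory.Measure Ω)
          [MeasureTheory.IsProbabilityMeasure μ]
          (Y : OrdinalTensor.Index d → Ω → Fin (M + 1))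
          (_ : OrdinalTensor.IsCumulativeLinkModel μ f b Θtrue Y),
          (∀ y : OrdinalTensor.Index d → Fin (M + 1),
            ∃ Θhat, OrdinalTensor.IsMLE f b r α y Θhat) ∧
          1 - 1 / ((⨅ k, d k : ℕ) : ℝ) ^ p ≤
            μ.real {x |
              (∀ Θhat, OrdinalTensor.IsMLE f b r α (fun ω => Y ω x) Θhat →
                OrdinalTensor.mse Θhat Θtrue ≤ OrdinalTensor.errorBound c₁ f b α d r) ∧
              (∀ Θ ∈ OrdinalTensor.paramSpace d r α,
                OrdinalTensor.logLik f b (fun ω => Y ω x) Θtrue ≤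
                  OrdinalTensor.logLik f b (fun ω => Y ω x) Θ →
                OrdinalTensor.mse Θ Θtrue ≤ OrdinalTensor.errorBound c₁ f b α d r)} := by

  refine ⟨32 * 4 ^ K * 2 ^ (K - 1), by positivity, fun p => ?_⟩
  obtain ⟨D, hD1, hD⟩ := OrdinalTensor.exists_forall_exp_neg_le p
  refine ⟨D, ?_⟩
  intro M hM f hf b hb α hα d r hd T hT Ω _ μ _ Y hY
  refine ⟨OrdinalTensor.exists_isMLE hf hM hb ⟨T, hT⟩, ?_⟩
  have hinf : ∀ k, ⨅ k, d k ≤ d k := fun k => ciInf_le (OrderBot.bddBelow _) k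
  have hdk : ∀ k, 1 ≤ d k := fun k => hD1.trans (hd.trans (hinf k))
  have hsum : ⨅ k, d k ≤ ∑ k, d k :=
    (hinf ⟨0, hK⟩).trans (Finset.single_le_sum (fun k _ => Nat.zero_le (d k)) (Finset.mem_univ _))
  have hU := OrdinalTensor.U_pos hf hM hb hα.le
  have hsq : √(8 * OrdinalTensor.U f b α ^ 2 * ∑ k, (d k : ℝ)) ^ 2 =
      8 * OrdinalTensor.U f b α ^ 2 * ∑ k, (d k : ℝ) := Real.sq_sqrt (by positivity)
  have hbad := OrdinalTensor.measure_spectral_compl_le (μ := μ)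
    (fun ω x => OrdinalTensor.score f b T ω (Y ω x))
    (fun ω => (measurable_of_finite (OrdinalTensor.score f b T ω)).comp (hY.measurable ω))
    (hY.indep.comp (fun ω => OrdinalTensor.score f b T ω) fun ω => measurable_of_finite _)
    (hY.integral_score hf hM hb) hU
    (fun ω x => OrdinalTensor.abs_score_le_U hf hM hb _ (by simpa using hT.2 ω))
    (Real.sqrt_nonneg _) hsq ((hD1.trans hd).trans hsum)
  have hexp : Real.exp (-∑ k, (d k : ℝ)) ≤ 1 / ((⨅ k, d k : ℕ) : ℝ) ^ p := by
    refine le_trans (Real.exp_le_exp.2 (neg_le_neg ?_)) (hD _ hd)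
    exact_mod_cast hsum
  set good := {x | (∀ Θhat, OrdinalTensor.IsMLE f b r α (fun ω => Y ω x) Θhat →
      OrdinalTensor.mse Θhat T ≤ OrdinalTensor.errorBound (32 * 4 ^ K * 2 ^ (K - 1)) f b α d r) ∧
    (∀ Θ ∈ OrdinalTensor.paramSpace d r α,
      OrdinalTensor.logLik f b (fun ω => Y ω x) T ≤ OrdinalTensor.logLik f b (fun ω => Y ω x) Θ →
      OrdinalTensor.mse Θ T ≤ OrdinalTensor.errorBound (32 * 4 ^ K * 2 ^ (K - 1)) f b α d r)}
  set bad := {x | ¬ ∀ v, |OrdinalTensor.form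
    (fun ω => OrdinalTensor.score f b T ω (Y ω x)) v| ≤
      2 ^ K * √(8 * OrdinalTensor.U f b α ^ 2 * ∑ k, (d k : ℝ)) * ∏ k, ‖v k‖}
  -- Covering and subadditivity bound the measure of `good` from below without measurability of
  -- either set.
  have hcover : (Set.univ : Set Ω) ⊆ good ∪ bad := by
    intro x _
    by_cases hx : x ∈ bad
    · exact Or.inr hx
    · have hform := not_not.1 hx
      have h2 : ∀ Θ ∈ OrdinalTensor.paramSpace d r α,
          OrdinalTensor.logLik f b (fun ω => Y ω x) T ≤
            OrdinalTensor.logLik f b (fun ω => Y ω x) Θ →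
          OrdinalTensor.mse Θ T ≤
            OrdinalTensor.errorBound (32 * 4 ^ K * 2 ^ (K - 1)) f b α d r := fun Θ hΘ hlik =>
        OrdinalTensor.mse_le_errorBound hΘ hT hdk hsq
          (OrdinalTensor.sum_sq_le_of_form_score_le hK hf hM hb hα.le hΘ hT (by positivity)
            hform hlik) rfl
      -- A maximizer has likelihood at least that of `T`, because `T` is feasible.
      exact Or.inl ⟨fun Θ hΘ => h2 Θ hΘ.1 (hΘ.2 T hT), h2⟩
  have h1 : (1 : ℝ) ≤ μ.real good + μ.real bad := by
    calc (1 : ℝ) = μ.real Set.univ := by simp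
      _ ≤ μ.real (good ∪ bad) := measureReal_mono hcover
      _ ≤ _ := measureReal_union_le _ _
  linarith
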